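/- Let $m:[0,\infty)\to[0,\infty)$ be (the restriction of) a smooth odd function with $m(0)=0$, $m'(0)=1$ and $m(r)>0$ for $r>0$, and let $(M,h)$ be a Riemannian surface of revolution with warp function $m$: $M$ is the plane, with geodesic polar coordinates $(r,\theta)$ around the vertex (the origin; $(r,\theta)$ denotes the point with Cartesian coordinates $(r\cos\theta,r\sin\theta)$), and $h$ is a smooth Riemannian metric on all of $M$, vertex included, such that $h=dr^2+m(r)^2\,d\theta^2$ for $r>0$. Let $\mu>0$ be a constant such that $m(r)<1/\mu$ for all $r\ge 0$, let $W=\mu\,\partial/\partial\theta$ (which vanishes at the vertex), and let $F=\alpha+\beta$ be the rotational Randers metric obtained by Zermelo navigation from $(h,W)$, i.e. $$F(x,y)=\frac{\sqrt{\lambda\,h(y,y)+h(W,y)^2}}{\lambda}-\frac{h(W,y)}{\lambda},\qquad \lambda=1-h(W,W)=1-\mu^2m^2 .$$ By a unit-speed geodesic of a Riemannian or Finsler metric we mean a smooth curve of unit speed satisfying the Euler–Lagrange equation of half the squared norm. Then, for every open interval $I\subseteq\mathbb R$ (for instance $(-\epsilon,\epsilon)$), the unit-speed $F$-geodesics $\mathcal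 P:I\to M$ are exactly the curves $$\mathcal P(s)=(r(s),\theta(s)+\mu s),\qquad s\in I,$$ where $\gamma(s)=(r(s),\theta(s))$, $s\in I$, runs over the unit-speed $h$-geodesics $\gamma:I\to M$ (those passing through the vertex included). -/

import Mathlib

open scoped ContDiff

noncomputable section

namespace RandersRotational

/-- The smooth plane underlying the surface, with Cartesian coordinates
`(r cos θ, r sin θ)` built from the geodesic polar coordinates `(r, θ)` around the vertex;
the vertex is the origin. Only the smooth structure of the plane is used: the geometry is
given by the metric `h` below. -/
abbrev Plane : Type := EuclideanSpace ℝ (Fin 2)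

/-- The point of the surface with polar coordinates `(r, θ)`. -/
def polar (r θ : ℝ) : Plane := !₂[r * Real.cos θ, r * Real.sin θ]

/-- The coordinate vector `∂/∂r` at the point with polar coordinates `(r, θ)`. -/
def dr (θ : ℝ) : Plane := !₂[Real.cos θ, Real.sin θ]

/-- The coordinate vector field `∂/∂θ`, i.e. the infinitesimal rotation about the vertex
(smooth on the whole surface, zero at the vertex). -/
def dθ (x : Plane) : Plane := !₂[-(x 1), x 0]

theorem hasDerivAt_polar_r (r θ : ℝ) : HasDerivAt (fun ρ => polar ρ θ) (dr θ) r := by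
  have h : (fun ρ => polar ρ θ) = fun ρ => ρ • dr θ := by
    funext ρ; ext i; fin_cases i <;> simp [polar, dr]
  rw [h]
  simpa using (hasDerivAt_id r).smul_const (dr θ)

theorem hasDerivAt_polar_θ (r θ : ℝ) :
    HasDerivAt (fun t => polar r t) (dθ (polar r θ)) θ := by
  have h : (fun t => polar r t) =
      fun t => Real.cos t • (!₂[r, 0] : Plane) + Real.sin t • (!₂[0, r] : Plane) := by
    funext t; ext i; fin_cases i <;> simp [polar, mul_comm]
  have h' : dθ (polar r θ) =
      (-Real.sin θ) • (!₂[r, 0] : Plane) + Real.cos θ • (!₂[0, r] : Plane) := by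
    ext i; fin_cases i <;> simp [polar, dθ, mul_comm]
  rw [h, h']
  exact ((Real.hasDerivAt_cos θ).smul_const _).add ((Real.hasDerivAt_sin θ).smul_const _)

/-- A smooth Riemannian metric on the surface: `h x` is the inner product on the tangent space
at `x`. -/
structure IsRiemannianMetric (h : Plane → Plane →L[ℝ] Plane →L[ℝ] ℝ) : Prop where
  smooth : ContDiff ℝ ∞ h
  symm : ∀ x v w, h x v w = h x w v
  pos : ∀ x v, v ≠ 0 → 0 < h x v v

/-- A warp function: a smooth odd function (given on `[0, ∞)`, extended to `ℝ` by oddness),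
positive for `r > 0`, with `m 0 = 0` and `m' 0 = 1`. -/
structure IsWarpFunction (m : ℝ → ℝ) : Prop where
  smooth : ContDiff ℝ ∞ m
  odd : ∀ r, m (-r) = -m r
  zero : m 0 = 0
  deriv_zero : deriv m 0 = 1
  pos : ∀ r, 0 < r → 0 < m r

/-- `h` is the Riemannian metric of a surface of revolution with warp function `m`:
`h` is a smooth Riemannian metric on the whole surface, vertex included, and
`h = dr² + m(r)² dθ²` in the polar coordinates. -/
structure IsSurfaceOfRevolution (h : Plane → Plane →L[ℝ] Plane →L[ℝ] ℝ) (m : ℝ → ℝ) :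
    Prop where
  metric : IsRiemannianMetric h
  warp : IsWarpFunction m
  rr : ∀ r θ, 0 < r → h (polar r θ) (dr θ) (dr θ) = 1
  rθ : ∀ r θ, 0 < r → h (polar r θ) (dr θ) (dθ (polar r θ)) = 0
  θθ : ∀ r θ, 0 < r → h (polar r θ) (dθ (polar r θ)) (dθ (polar r θ)) = m r ^ 2

/-- The norm `√h(y, y)` of a Riemannian metric, as a function of position `x` and velocity `y`. -/
def riemannNorm (h : Plane → Plane →L[ℝ] Plane →L[ℝ] ℝ) (x y : Plane) : ℝ :=
  Real.sqrt (h x y y)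

/-- `λ = 1 - h(W, W)`. -/
def lam (h : Plane → Plane →L[ℝ] Plane →L[ℝ] ℝ) (W : Plane → Plane) (x : Plane) : ℝ :=
  1 - h x (W x) (W x)

/-- `α = √(aᵢⱼ yⁱ yʲ)` with `aᵢⱼ = (λ hᵢⱼ + Wᵢ Wⱼ) / λ²`. -/
def randersAlpha (h : Plane → Plane →L[ℝ] Plane →L[ℝ] ℝ) (W : Plane → Plane)
    (x y : Plane) : ℝ :=
  Real.sqrt ((lam h W x * h x y y + h x (W x) y ^ 2) / lam h W x ^ 2)

/-- `β = bᵢ yⁱ` with `bᵢ = -Wᵢ / λ`. -/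
def randersBeta (h : Plane → Plane →L[ℝ] Plane →L[ℝ] ℝ) (W : Plane → Plane)
    (x y : Plane) : ℝ :=
  -(h x (W x) y) / lam h W x

/-- The Randers metric `F = α + β` obtained by Zermelo navigation from the data `(h, W)`. -/
def randers (h : Plane → Plane →L[ℝ] Plane →L[ℝ] ℝ) (W : Plane → Plane)
    (x y : Plane) : ℝ :=
  randersAlpha h W x y + randersBeta h W x y

/-- Unit-speed geodesics, parametrized by the open set `I ⊆ ℝ`, of a Finsler metric `F x y`
(a Riemannian metric enters through its norm): smooth curves `c` with `F(c, c') = 1` that satisfy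
the Euler-Lagrange equation `d/ds (∂L/∂y) (c, c') = (∂L/∂x) (c, c')` of the energy Lagrangian
`L(x, y) = F(x, y)² / 2`. -/
def IsUnitSpeedGeodesicOn (F : Plane → Plane → ℝ) (I : Set ℝ) (c : ℝ → Plane) : Prop :=
  ContDiffOn ℝ ∞ c I ∧
  (∀ s ∈ I, F (c s) (deriv c s) = 1) ∧
  ∀ s ∈ I, HasDerivAt
    (fun t => fderiv ℝ (fun y => F (c t) y ^ 2 / 2) (deriv c t))
    (fderiv ℝ (fun x => F x (deriv c s) ^ 2 / 2) (c s)) s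

end RandersRotational

end

open scoped ContDiff

noncomputable section

namespace RandersRotational

/-! Rotations are isometries of `h`, so `W` is Killing. Write `P = rot (μ s) γ` and let `u` be the
rotated velocity of `γ`, so that `P' = u + W`. The navigation metric has as unit sphere that of `h`
translated by `W`; hence `F(P') = 1` exactly when `γ` has unit speed.

Where `F = 1`, implicit differentiation of `λF² + 2h(W,y)F = h(y,y)` shows that the `F`-momentum is
`q / D`, with `q = h(u, ·)` and `D = 1 + h(u, W)`, and that the `F`-force is `G / D`. In the
rotating frame the equation for `γ` reads `q' = G` with the same `G`. The Killing equation gives `D'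
= (q' - G)(W)` (`hasDerivAt_clairaut`), so `q' = G` makes `D` constant and yields `(q / D)' = G /
D`. Conversely, the latter says `D (q' - G) = D' q`; evaluated at `W` this forces `D' = 0`, hence
`q' = G` (`euler_randers_iff`). All of this is coordinate-free, so the vertex needs no separate
treatment. -/

/-! ### Rotations and polar frames -/

/-- The rotation generator `x ↦ ∂/∂θ` as a continuous linear map. -/
def rotGen : Plane →L[ℝ] Plane :=
  LinearMap.toContinuousLinearMap
    { toFun := dθ
      map_add' := fun x y => by ext i; fin_cases i <;> simp [dθ, add_comm]
      map_smul' := fun c x => by ext i; fin_cases i <;> simp [dθ] }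

@[simp] theorem rotGen_apply (x : Plane) : rotGen x = dθ x := rfl

/-- The rotation of the plane by the angle `t`. -/
def rot (t : ℝ) : Plane →L[ℝ] Plane :=
  Real.cos t • ContinuousLinearMap.id ℝ Plane + Real.sin t • rotGen

theorem rot_apply (t : ℝ) (x : Plane) :
    rot t x = !₂[Real.cos t * x 0 - Real.sin t * x 1, Real.sin t * x 0 + Real.cos t * x 1] := by
  ext i
  fin_cases i <;> simp [rot, dθ] <;> ring

theorem rot_rot (s t : ℝ) (x : Plane) : rot s (rot t x) = rot (s + t) x := by
  ext i
  fin_cases i <;> simp [rot_apply, Real.cos_add, Real.sin_add] <;> ring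

@[simp] theorem rot_zero (x : Plane) : rot 0 x = x := by simp [rot]

@[simp] theorem rot_neg_rot (t : ℝ) (x : Plane) : rot (-t) (rot t x) = x := by simp [rot_rot]

@[simp] theorem rot_rot_neg (t : ℝ) (x : Plane) : rot t (rot (-t) x) = x := by simp [rot_rot]

theorem rot_polar (t r θ : ℝ) : rot t (polar r θ) = polar r (θ + t) := by
  ext i
  fin_cases i <;> simp [rot_apply, polar, Real.cos_add, Real.sin_add] <;> ring

theorem rot_dr (t θ : ℝ) : rot t (dr θ) = dr (θ + t) := by
  ext i
  fin_cases i <;> simp [rot_apply, dr, Real.cos_add, Real.sin_add] <;> ring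

theorem rot_dθ (t : ℝ) (x : Plane) : rot t (dθ x) = dθ (rot t x) := by
  ext i
  fin_cases i <;> simp [rot_apply, dθ] <;> ring

theorem hasDerivAt_rot (t : ℝ) : HasDerivAt rot (rotGen.comp (rot t)) t := by
  have h := ((Real.hasDerivAt_cos t).smul_const (ContinuousLinearMap.id ℝ Plane)).add
    ((Real.hasDerivAt_sin t).smul_const rotGen)
  refine h.congr_deriv ?_
  ext x i
  fin_cases i <;> simp [rot, dθ] <;> ring

theorem hasDerivAt_rot_mul (μ s : ℝ) :
    HasDerivAt (fun t => rot (μ * t)) (μ • rotGen.comp (rot (μ * s))) s := by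
  have h := (hasDerivAt_rot (μ * s)).scomp s ((hasDerivAt_id s).const_mul μ)
  simpa [Function.comp_def] using h

theorem contDiff_rot : ContDiff ℝ ∞ rot :=
  (Real.contDiff_cos.smul contDiff_const).add (Real.contDiff_sin.smul contDiff_const)

theorem exists_eq_polar (x : Plane) : ∃ r θ : ℝ, 0 ≤ r ∧ x = polar r θ := by
  refine ⟨‖(⟨x 0, x 1⟩ : ℂ)‖, Complex.arg ⟨x 0, x 1⟩, norm_nonneg _, ?_⟩
  ext i
  fin_cases i
  · simp [polar, Complex.norm_mul_cos_arg]
  · simp [polar, Complex.norm_mul_sin_arg]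

theorem exists_eq_polar_of_ne_zero {x : Plane} (hx : x ≠ 0) :
    ∃ r θ : ℝ, 0 < r ∧ x = polar r θ := by
  obtain ⟨r, θ, hr, rfl⟩ := exists_eq_polar x
  refine ⟨r, θ, lt_of_le_of_ne hr ?_, rfl⟩
  rintro rfl
  refine hx ?_
  ext i
  fin_cases i <;> simp [polar]

theorem eq_dr_add_dθ {r : ℝ} (hr : 0 < r) (θ : ℝ) (v : Plane) :
    ∃ a b : ℝ, v = a • dr θ + b • dθ (polar r θ) := by
  refine ⟨v 0 * Real.cos θ + v 1 * Real.sin θ,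
    (v 1 * Real.cos θ - v 0 * Real.sin θ) / r, ?_⟩
  have h := Real.sin_sq_add_cos_sq θ
  ext i
  fin_cases i
  · simp [dr, dθ, polar]
    field_simp
    linear_combination (-v 0) * h
  · simp [dr, dθ, polar]
    field_simp
    linear_combination (-v 1) * h

/-! ### Rotational symmetry of the metric -/

namespace IsSurfaceOfRevolution

variable {h : Plane → Plane →L[ℝ] Plane →L[ℝ] ℝ} {m : ℝ → ℝ}

theorem apply_polar (hm : IsSurfaceOfRevolution h m) {r : ℝ} (hr : 0 < r) (θ a b c d : ℝ) :
    h (polar r θ) (a • dr θ + b • dθ (polar r θ)) (c • dr θ + d • dθ (polar r θ)) =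
      a * c + b * d * m r ^ 2 := by
  have e1 := hm.rr r θ hr
  have e2 := hm.rθ r θ hr
  have e3 := hm.θθ r θ hr
  have e4 := hm.metric.symm (polar r θ) (dθ (polar r θ)) (dr θ)
  rw [e2] at e4
  simp [e1, e2, e3, e4]
  ring

/-- Rotations are isometries of a surface of revolution, also at the vertex. -/
theorem rot_invariant (hm : IsSurfaceOfRevolution h m) (t : ℝ) (x v w : Plane) :
    h (rot t x) (rot t v) (rot t w) = h x v w := by
  have hc : Continuous h := hm.metric.smooth.continuous
  have key : Set.EqOn (fun x => h (rot t x) (rot t v) (rot t w)) (fun x => h x v w) {0}ᶜ := by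
    intro x hx
    obtain ⟨r, θ, hr, rfl⟩ := exists_eq_polar_of_ne_zero hx
    obtain ⟨a, b, rfl⟩ := eq_dr_add_dθ hr θ v
    obtain ⟨c, d, rfl⟩ := eq_dr_add_dθ hr θ w
    simp only [map_add, map_smul, rot_dr, rot_dθ, rot_polar]
    simp only [← map_add, ← map_smul]
    rw [hm.apply_polar hr, hm.apply_polar hr]
  -- The polar form of `h` says nothing at the vertex; continuity extends the identity there.
  have hd : Dense ({0}ᶜ : Set Plane) := dense_compl_singleton 0
  have := Continuous.ext_on hd (by fun_prop) (by fun_prop) key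
  exact congrFun this x

theorem differentiableAt (hm : IsSurfaceOfRevolution h m) (x : Plane) : DifferentiableAt ℝ h x :=
  hm.metric.smooth.differentiable (by simp) x

theorem fderiv_rot (hm : IsSurfaceOfRevolution h m) (t : ℝ) (x v u w : Plane) :
    fderiv ℝ h (rot t x) (rot t v) (rot t u) (rot t w) = fderiv ℝ h x v u w := by
  have h1 : HasFDerivAt (fun x => h (rot t x) (rot t u) (rot t w)) _ x :=
    ((((hm.differentiableAt (rot t x)).hasFDerivAt.comp x (rot t).hasFDerivAt).clm_apply
      (hasFDerivAt_const (rot t u) x)).clm_apply (hasFDerivAt_const (rot t w) x))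
  have h2 : HasFDerivAt (fun x => h x u w) _ x :=
    (((hm.differentiableAt x).hasFDerivAt.clm_apply
      (hasFDerivAt_const u x)).clm_apply (hasFDerivAt_const w x))
  simp only [hm.rot_invariant] at h1
  simpa using DFunLike.congr_fun (h1.unique h2) v

theorem hasDerivAt_apply (hm : IsSurfaceOfRevolution h m) {c a b : ℝ → Plane}
    {c' a' b' : Plane} {s : ℝ} (hc : HasDerivAt c c' s) (ha : HasDerivAt a a' s)
    (hb : HasDerivAt b b' s) :
    HasDerivAt (fun t => h (c t) (a t) (b t))
      (fderiv ℝ h (c s) c' (a s) (b s) + h (c s) a' (b s) + h (c s) (a s) b') s := by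
  have h0 : HasFDerivAt h (fderiv ℝ h (c s)) (c s) := (hm.differentiableAt (c s)).hasFDerivAt
  have h1 : HasDerivAt (fun t => h (c t)) (fderiv ℝ h (c s) c') s :=
    HasFDerivAt.comp_hasDerivAt (l := h) (f := c) s h0 hc
  have h2 := (h1.clm_apply ha).clm_apply hb
  refine h2.congr_deriv ?_
  simp

/-- The rotation field is a Killing field. -/
theorem killing (hm : IsSurfaceOfRevolution h m) (x u : Plane) :
    fderiv ℝ h x (dθ x) u u + 2 * h x u (dθ u) = 0 := by
  have hr (v : Plane) : HasDerivAt (fun t => rot t v) (dθ v) 0 := by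
    simpa using (hasDerivAt_rot 0).clm_apply (hasDerivAt_const (0 : ℝ) v)
  have h1 := hm.hasDerivAt_apply (hr x) (hr u) (hr u)
  -- Invariance turns the differentiated function into a constant.
  simp only [hm.rot_invariant, rot_zero] at h1
  have h2 := h1.unique (hasDerivAt_const (0 : ℝ) (h x u u))
  rw [hm.metric.symm x (dθ u) u] at h2
  linarith

theorem lam_pos (hm : IsSurfaceOfRevolution h m) {μ : ℝ} (hμ : 0 < μ)
    (hbound : ∀ r : ℝ, 0 ≤ r → m r < 1 / μ) (x : Plane) :
    0 < lam h (fun x => μ • dθ x) x := by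
  by_cases hx : x = 0
  · have : dθ (0 : Plane) = 0 := rotGen.map_zero
    simp [lam, hx, this]
  · obtain ⟨r, θ, hr, rfl⟩ := exists_eq_polar_of_ne_zero hx
    have h1 := hm.warp.pos r hr
    have h2 : m r * μ < 1 := (lt_div_iff₀ hμ).1 (hbound r hr.le)
    have h3 : 0 < m r * μ := mul_pos h1 hμ
    simp only [lam, map_smul, smul_apply, smul_eq_mul, hm.θθ r θ hr]
    nlinarith

end IsSurfaceOfRevolution

/-! ### The Zermelo quadratic -/

/-- The value `f = (√(l A + B²) - B) / l` is the positive root of `l f² + 2 B f = A`. -/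
theorem zermelo_quadratic {A B l : ℝ} (hl : 0 < l) (hA : 0 ≤ A) :
    l * (Real.sqrt ((l * A + B ^ 2) / l ^ 2) + -B / l) ^ 2 +
      2 * B * (Real.sqrt ((l * A + B ^ 2) / l ^ 2) + -B / l) - A = 0 := by
  have h := Real.sq_sqrt (show 0 ≤ (l * A + B ^ 2) / l ^ 2 by positivity)
  have h' : l * (Real.sqrt ((l * A + B ^ 2) / l ^ 2)) ^ 2 = A + B ^ 2 / l := by
    rw [h]; field_simp
  generalize Real.sqrt ((l * A + B ^ 2) / l ^ 2) = S at *
  have e : l * (S + -B / l) ^ 2 + 2 * B * (S + -B / l) = l * S ^ 2 - B ^ 2 / l := by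
    field_simp; ring
  rw [e, h']; ring

/-- Where the value is `1`, the Zermelo condition is `A - 2 B - l = 0`. -/
theorem zermelo_eq_one_iff {A B l : ℝ} (hl : 0 < l) (hA : 0 ≤ A) :
    Real.sqrt ((l * A + B ^ 2) / l ^ 2) + -B / l = 1 ↔ A = l + 2 * B ∧ 0 ≤ l + B := by
  constructor
  · intro hf
    have h1 := zermelo_quadratic (B := B) hl hA
    rw [hf] at h1
    refine ⟨by linarith, ?_⟩
    have h2 : Real.sqrt ((l * A + B ^ 2) / l ^ 2) = (l + B) / l := by
      field_simp; field_simp at hf; linarith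
    have h3 : 0 ≤ (l + B) / l := h2 ▸ Real.sqrt_nonneg _
    have h4 := mul_nonneg h3 hl.le
    rwa [div_mul_cancel₀ _ hl.ne'] at h4
  · rintro ⟨rfl, h2⟩
    have : (l * (l + 2 * B) + B ^ 2) / l ^ 2 = ((l + B) / l) ^ 2 := by
      field_simp; ring
    rw [this, Real.sqrt_sq (by positivity)]
    field_simp
    ring

/-- Implicit differentiation of `l f² + 2 B f = A` where `f = 1`, stated over a general space to
serve both position and velocity derivatives. -/
theorem zermelo_hasFDerivAt {E : Type*} [NormedAddCommGroup E] [NormedSpace ℝ E]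
    {A B l : E → ℝ} {A' B' l' : E →L[ℝ] ℝ} {a : E}
    (hA : HasFDerivAt A A' a) (hB : HasFDerivAt B B' a) (hl : HasFDerivAt l l' a)
    (lpos : ∀ x, 0 < l x) (Anonneg : ∀ x, 0 ≤ A x) (Apos : 0 < A a)
    (hf : Real.sqrt ((l a * A a + B a ^ 2) / l a ^ 2) + -B a / l a = 1) :
    HasFDerivAt (fun x => (Real.sqrt ((l x * A x + B x ^ 2) / l x ^ 2) + -B x / l x) ^ 2 / 2)
      ((2 * (l a + B a))⁻¹ • (A' - l' - (2 : ℝ) • B')) a := by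
  obtain ⟨hA1, hD⟩ := (zermelo_eq_one_iff (lpos a) (Apos.le)).1 hf
  have hla := lpos a
  have hD' : 0 < l a + B a := by
    -- If `l + B = 0`, then `A = l + 2 B = -l < 0`.
    refine lt_of_le_of_ne hD fun h0 => ?_
    linarith
  set f : E → ℝ := fun x => Real.sqrt ((l x * A x + B x ^ 2) / l x ^ 2) + -B x / l x with hfdef
  have hfd : DifferentiableAt ℝ f a := by
    have hA' := hA.differentiableAt
    have hB' := hB.differentiableAt
    have hl' := hl.differentiableAt
    have h1 : (l a) ^ 2 ≠ 0 := by positivity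
    -- The square root is differentiable only away from zero.
    have h2 : (l a * A a + B a ^ 2) / l a ^ 2 ≠ 0 := by positivity
    have h3 : l a ≠ 0 := hla.ne'
    simp only [hfdef, div_eq_mul_inv] at h2 ⊢
    fun_prop (disch := assumption)
  have hf1 : f a = 1 := hf
  have hff := hfd.hasFDerivAt
  have hq := (((hl.mul (hff.pow 2)).add ((hB.const_mul 2).mul hff)).sub hA)
  have h0 : (fun x => l x * f x ^ 2 + 2 * B x * f x - A x) = fun _ => 0 :=
    funext fun x => zermelo_quadratic (lpos x) (Anonneg x)
  have hq' : HasFDerivAt (fun x => l x * f x ^ 2 + 2 * B x * f x - A x) _ a := hq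
  rw [h0] at hq'
  have heq := hq'.unique (hasFDerivAt_const (0 : ℝ) a)
  have h2 := (hff.pow 2).mul_const (2⁻¹ : ℝ)
  refine (h2.congr_fderiv ?_).congr_of_eventuallyEq (Filter.Eventually.of_forall fun x => 
    (div_eq_mul_inv (f x ^ 2) 2))
  ext v
  have hv := DFunLike.congr_fun heq v
  simp [hf1] at hv
  simp [hf1]
  field_simp
  linarith

/-! ### Derivatives of the two energies -/

namespace IsSurfaceOfRevolution

variable {h : Plane → Plane →L[ℝ] Plane →L[ℝ] ℝ} {m : ℝ → ℝ}

theorem apply_self_nonneg (hm : IsSurfaceOfRevolution h m) (x y : Plane) : 0 ≤ h x y y := by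
  by_cases hy : y = 0
  · simp [hy]
  · exact (hm.metric.pos x y hy).le

theorem hasFDerivAt_apply (hm : IsSurfaceOfRevolution h m) {a b : Plane → Plane}
    {a' b' : Plane →L[ℝ] Plane} {x : Plane} (ha : HasFDerivAt a a' x) (hb : HasFDerivAt b b' x) :
    HasFDerivAt (fun x => h x (a x) (b x))
      (((fderiv ℝ h x).flip (a x)).flip (b x) + ((h x).flip (b x)).comp a' +
        (h x (a x)).comp b') x := by
  have h0 : HasFDerivAt h (fderiv ℝ h x) x := (hm.differentiableAt x).hasFDerivAt
  refine ((h0.clm_apply ha).clm_apply hb).congr_fderiv ?_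
  ext v
  simp
  ring

theorem riemannNorm_sq_div_two (hm : IsSurfaceOfRevolution h m) (x y : Plane) :
    riemannNorm h x y ^ 2 / 2 = h x y y * 2⁻¹ := by
  rw [riemannNorm, Real.sq_sqrt (hm.apply_self_nonneg x y), div_eq_mul_inv]

theorem fderiv_riemannNorm_velocity (hm : IsSurfaceOfRevolution h m) (x y : Plane) :
    fderiv ℝ (fun y => riemannNorm h x y ^ 2 / 2) y = h x y := by
  simp only [hm.riemannNorm_sq_div_two]
  have h1 := (((h x).hasFDerivAt (x := y)).clm_apply (hasFDerivAt_id y)).mul_const (2⁻¹ : ℝ)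
  refine (h1.congr_fderiv ?_).fderiv
  ext v
  simp [hm.metric.symm x v y]
  ring

theorem fderiv_riemannNorm_position (hm : IsSurfaceOfRevolution h m) (x y : Plane) :
    fderiv ℝ (fun x => riemannNorm h x y ^ 2 / 2) x =
      (2⁻¹ : ℝ) • ((fderiv ℝ h x).flip y).flip y := by
  simp only [hm.riemannNorm_sq_div_two]
  have h1 := (hm.hasFDerivAt_apply (hasFDerivAt_const y x) (hasFDerivAt_const y x)).mul_const
    (2⁻¹ : ℝ)
  refine (h1.congr_fderiv ?_).fderiv
  ext v
  simp

section Zermelo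

variable {μ : ℝ}

theorem lam_eq (x : Plane) :
    lam h (fun x => μ • dθ x) x = 1 - h x (μ • rotGen x) (μ • rotGen x) := rfl

theorem randers_eq (x y : Plane) :
    randers h (fun x => μ • dθ x) x y =
      Real.sqrt ((lam h (fun x => μ • dθ x) x * h x y y + h x (μ • rotGen x) y ^ 2) /
        lam h (fun x => μ • dθ x) x ^ 2) + -h x (μ • rotGen x) y /
        lam h (fun x => μ • dθ x) x := rfl

theorem lam_add_apply (hm : IsSurfaceOfRevolution h m) (x y : Plane) :
    lam h (fun x => μ • dθ x) x + h x (μ • rotGen x) y =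
      1 + h x (y - μ • rotGen x) (μ • rotGen x) := by
  have := hm.metric.symm x y (μ • rotGen x)
  simp only [lam_eq, map_sub, sub_apply]
  linarith

theorem pos_of_randers_eq_one (hm : IsSurfaceOfRevolution h m) {x y : Plane}
    (hF : randers h (fun x => μ • dθ x) x y = 1) : 0 < h x y y := by
  refine hm.metric.pos x y ?_
  rintro rfl
  simp [randers_eq] at hF

/-- Zermelo navigation translates the unit sphere of `h` by the wind. -/
theorem randers_eq_one_iff (hm : IsSurfaceOfRevolution h m) (hμ : 0 < μ)
    (hbound : ∀ r : ℝ, 0 ≤ r → m r < 1 / μ) (x y : Plane) :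
    randers h (fun x => μ • dθ x) x y = 1 ↔
      riemannNorm h x (y - μ • rotGen x) = 1 := by
  have hl := hm.lam_pos hμ hbound x
  rw [randers_eq, zermelo_eq_one_iff hl (hm.apply_self_nonneg x y), riemannNorm,
    Real.sqrt_eq_one]
  have hs := hm.metric.symm x y (μ • rotGen x)
  have e : h x (y - μ • rotGen x) (y - μ • rotGen x) =
      h x y y - 2 * h x (μ • rotGen x) y + (1 - lam h (fun x => μ • dθ x) x) := by
    simp only [lam_eq, map_sub, sub_apply]
    linarith
  rw [e]
  constructor
  · rintro ⟨h1, -⟩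
    linarith
  · intro h1
    -- The sign condition is automatic: `2 (l + B) = A + l > 0`.
    refine ⟨by linarith, ?_⟩
    have := hm.apply_self_nonneg x y
    linarith

theorem randers_denominator_pos (hm : IsSurfaceOfRevolution h m) (hμ : 0 < μ)
    (hbound : ∀ r : ℝ, 0 ≤ r → m r < 1 / μ) {x y : Plane}
    (hF : randers h (fun x => μ • dθ x) x y = 1) :
    0 < 1 + h x (y - μ • rotGen x) (μ • rotGen x) := by
  have hA := hm.pos_of_randers_eq_one hF
  have hl := hm.lam_pos hμ hbound x
  rw [← hm.lam_add_apply]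
  rw [randers_eq, zermelo_eq_one_iff hl hA.le] at hF
  refine lt_of_le_of_ne hF.2 fun h0 => ?_
  linarith [hF.1]

theorem fderiv_randers_velocity (hm : IsSurfaceOfRevolution h m) (hμ : 0 < μ)
    (hbound : ∀ r : ℝ, 0 ≤ r → m r < 1 / μ) {x y : Plane}
    (hF : randers h (fun x => μ • dθ x) x y = 1) :
    fderiv ℝ (fun y => randers h (fun x => μ • dθ x) x y ^ 2 / 2) y =
      (1 + h x (y - μ • rotGen x) (μ • rotGen x))⁻¹ • h x (y - μ • rotGen x) := by
  have hA : HasFDerivAt (fun y => h x y y) _ y :=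
    ((h x).hasFDerivAt (x := y)).clm_apply (hasFDerivAt_id y)
  have h1 := zermelo_hasFDerivAt hA (h x (μ • rotGen x)).hasFDerivAt
    (hasFDerivAt_const (lam h (fun x => μ • dθ x) x) y) (fun _ => hm.lam_pos hμ hbound x)
    (hm.apply_self_nonneg x) (hm.pos_of_randers_eq_one hF) hF
  refine (h1.congr_fderiv ?_).fderiv
  rw [hm.lam_add_apply, mul_inv]
  ext v
  have hv := hm.metric.symm x v y
  simp only [smul_apply, sub_apply, add_apply, ContinuousLinearMap.comp_apply,
    ContinuousLinearMap.flip_apply, ContinuousLinearMap.id_apply, zero_apply, map_sub,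
    smul_eq_mul, hv]
  ring

theorem fderiv_randers_position (hm : IsSurfaceOfRevolution h m) (hμ : 0 < μ)
    (hbound : ∀ r : ℝ, 0 ≤ r → m r < 1 / μ) {x y : Plane}
    (hF : randers h (fun x => μ • dθ x) x y = 1) :
    fderiv ℝ (fun x => randers h (fun x => μ • dθ x) x y ^ 2 / 2) x =
      (1 + h x (y - μ • rotGen x) (μ • rotGen x))⁻¹ •
        ((2⁻¹ : ℝ) • ((fderiv ℝ h x).flip (y - μ • rotGen x)).flip (y - μ • rotGen x) -
          (h x (y - μ • rotGen x)).comp (μ • rotGen)) := by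
  have hW : HasFDerivAt (fun x => μ • rotGen x) (μ • rotGen) x := rotGen.hasFDerivAt.const_smul μ
  have hA := hm.hasFDerivAt_apply (hasFDerivAt_const y x) (hasFDerivAt_const y x)
  have hB := hm.hasFDerivAt_apply hW (hasFDerivAt_const y x)
  have hl := (hm.hasFDerivAt_apply hW hW).const_sub 1
  have h1 := zermelo_hasFDerivAt hA hB hl (hm.lam_pos hμ hbound)
    (fun x => hm.apply_self_nonneg x y) (hm.pos_of_randers_eq_one hF) hF
  refine (h1.congr_fderiv ?_).fderiv
  rw [← lam_eq, hm.lam_add_apply, mul_inv]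
  ext v
  -- The derivative of `h` inherits its symmetry, by uniqueness of derivatives.
  have e1 : fderiv ℝ h x v y (μ • rotGen x) = fderiv ℝ h x v (μ • rotGen x) y := by
    have h2 := hm.hasFDerivAt_apply (hasFDerivAt_const y x)
      (hasFDerivAt_const (μ • rotGen x) x)
    have h3 := hm.hasFDerivAt_apply (hasFDerivAt_const (μ • rotGen x) x)
      (hasFDerivAt_const y x)
    simp only [fun z => hm.metric.symm z y (μ • rotGen x)] at h2
    simpa using DFunLike.congr_fun (h2.unique h3) v
  have e2 := hm.metric.symm x (μ • rotGen v) (μ • rotGen x)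
  have e3 := hm.metric.symm x (μ • rotGen v) y
  simp only [smul_apply, sub_apply, add_apply, neg_apply, ContinuousLinearMap.comp_apply,
    ContinuousLinearMap.flip_apply, zero_apply, map_sub,
    smul_eq_mul, e1, e2, e3, map_zero]
  ring

end Zermelo

/-! ### Comparison of the Euler-Lagrange equations -/

theorem hasDerivAt_momentum (hm : IsSurfaceOfRevolution h m) {c u : ℝ → Plane}
    {c' u' : Plane} {s : ℝ} (hc : HasDerivAt c c' s) (hu : HasDerivAt u u' s) :
    HasDerivAt (fun t => h (c t) (u t)) (fderiv ℝ h (c s) c' (u s) + h (c s) u') s := by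
  have h0 : HasFDerivAt h (fderiv ℝ h (c s)) (c s) := (hm.differentiableAt (c s)).hasFDerivAt
  have h1 : HasDerivAt (fun t => h (c t)) (fderiv ℝ h (c s) c') s :=
    HasFDerivAt.comp_hasDerivAt (l := h) (f := c) s h0 hc
  exact h1.clm_apply hu

theorem riemannNorm_rot (hm : IsSurfaceOfRevolution h m) (t : ℝ) (x y : Plane) :
    riemannNorm h (rot t x) (rot t y) = riemannNorm h x y := by
  simp only [riemannNorm, hm.rot_invariant]

/-- The Euler-Lagrange equation of `h` for a curve, expressed through the momentum `q` of the
curve rotated with angular velocity `μ`. -/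
theorem euler_riemann_iff (hm : IsSurfaceOfRevolution h m) {μ s : ℝ} {I : Set ℝ}
    (hI : IsOpen I) (hs : s ∈ I) {γ P v u : ℝ → Plane} {q' : Plane →L[ℝ] ℝ}
    (hP : ∀ t ∈ I, P t = rot (μ * t) (γ t)) (hu : ∀ t ∈ I, u t = rot (μ * t) (v t))
    (hq : HasDerivAt (fun t => h (P t) (u t)) q' s) :
    HasDerivAt (fun t => fderiv ℝ (fun y => riemannNorm h (γ t) y ^ 2 / 2) (v t))
        (fderiv ℝ (fun x => riemannNorm h x (v s) ^ 2 / 2) (γ s)) s ↔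
      q' = (2⁻¹ : ℝ) • ((fderiv ℝ h (P s)).flip (u s)).flip (u s) -
        (h (P s) (u s)).comp (μ • rotGen) := by
  simp only [hm.fderiv_riemannNorm_velocity, hm.fderiv_riemannNorm_position]
  have hev : (fun t => h (γ t) (v t)) =ᶠ[nhds s]
      fun t => (h (P t) (u t)).comp (rot (μ * t)) := by
    filter_upwards [hI.mem_nhds hs] with t ht
    ext w
    simp [hP t ht, hu t ht, hm.rot_invariant]
  have hd : HasDerivAt (fun t => (h (P t) (u t)).comp (rot (μ * t)))
      (q'.comp (rot (μ * s)) + (h (P s) (u s)).comp (μ • rotGen.comp (rot (μ * s)))) s :=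
    hq.clm_comp (hasDerivAt_rot_mul μ s)
  rw [hev.hasDerivAt_iff]
  have hpos : (2⁻¹ : ℝ) • ((fderiv ℝ h (γ s)).flip (v s)).flip (v s) =
      ((2⁻¹ : ℝ) • ((fderiv ℝ h (P s)).flip (u s)).flip (u s)).comp (rot (μ * s)) := by
    ext w
    simp [hP s hs, hu s hs, hm.fderiv_rot]
  rw [hpos]
  constructor
  · intro hE
    have e := hd.unique hE
    ext w
    -- This test vector undoes the rotation.
    have ew := DFunLike.congr_fun e (rot (-(μ * s)) w)
    simp at ew ⊢
    linarith
  · rintro rfl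
    refine hd.congr_deriv ?_
    ext w
    simp

/-- Along a curve with velocity `u + W`, the momentum `h(W, u)` of the rotation changes only by
the failure of the Euler-Lagrange equation. -/
theorem hasDerivAt_clairaut (hm : IsSurfaceOfRevolution h m) {μ s : ℝ} {P u : ℝ → Plane}
    {q' : Plane →L[ℝ] ℝ} (hP : HasDerivAt P (u s + μ • rotGen (P s)) s)
    (hq : HasDerivAt (fun t => h (P t) (u t)) q' s) :
    HasDerivAt (fun t => h (P t) (u t) (μ • rotGen (P t)))
      ((q' - ((2⁻¹ : ℝ) • ((fderiv ℝ h (P s)).flip (u s)).flip (u s) -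
        (h (P s) (u s)).comp (μ • rotGen))) (μ • rotGen (P s))) s := by
  have hW : HasDerivAt (fun t => μ • rotGen (P t)) (μ • rotGen (u s + μ • rotGen (P s))) s :=
    (rotGen.hasFDerivAt.comp_hasDerivAt s hP).const_smul μ
  refine (hq.clm_apply hW).congr_deriv ?_
  have hK := hm.killing (P s) (u s)
  rw [map_add rotGen, map_smul rotGen]
  simp
  linear_combination (μ / 2) * hK

/-- The right side is that of `euler_riemann_iff`, so the two equations agree once both are written
through `q'`. -/
theorem euler_randers_iff (hm : IsSurfaceOfRevolution h m) {μ s : ℝ} (hμ : 0 < μ)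
    (hbound : ∀ r : ℝ, 0 ≤ r → m r < 1 / μ) {I : Set ℝ}
    (hI : IsOpen I) (hs : s ∈ I) {P u : ℝ → Plane} {q' : Plane →L[ℝ] ℝ}
    (hP : ∀ t ∈ I, HasDerivAt P (u t + μ • rotGen (P t)) t)
    (hF : ∀ t ∈ I, randers h (fun x => μ • dθ x) (P t) (deriv P t) = 1)
    (hq : HasDerivAt (fun t => h (P t) (u t)) q' s) :
    HasDerivAt (fun t => fderiv ℝ
          (fun y => randers h (fun x => μ • dθ x) (P t) y ^ 2 / 2) (deriv P t))
        (fderiv ℝ (fun x => randers h (fun x => μ • dθ x) x (deriv P s) ^ 2 / 2) (P s)) s ↔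
      q' = (2⁻¹ : ℝ) • ((fderiv ℝ h (P s)).flip (u s)).flip (u s) -
        (h (P s) (u s)).comp (μ • rotGen) := by
  have hPu : ∀ t ∈ I, deriv P t - μ • rotGen (P t) = u t := fun t ht => by
    rw [(hP t ht).deriv]; abel
  rw [hm.fderiv_randers_position hμ hbound (hF s hs), hPu s hs]
  have hev : (fun t => fderiv ℝ
      (fun y => randers h (fun x => μ • dθ x) (P t) y ^ 2 / 2) (deriv P t)) =ᶠ[nhds s]
      fun t => (1 + h (P t) (u t) (μ • rotGen (P t)))⁻¹ • h (P t) (u t) := by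
    filter_upwards [hI.mem_nhds hs] with t ht
    rw [hm.fderiv_randers_velocity hμ hbound (hF t ht), hPu t ht]
  rw [hev.hasDerivAt_iff]
  have hD : 0 < 1 + h (P s) (u s) (μ • rotGen (P s)) := by
    have := hm.randers_denominator_pos hμ hbound (hF s hs)
    rwa [hPu s hs] at this
  have hD' := (hm.hasDerivAt_clairaut (hP s hs) hq).const_add 1
  set G := (2⁻¹ : ℝ) • ((fderiv ℝ h (P s)).flip (u s)).flip (u s) -
        (h (P s) (u s)).comp (μ • rotGen) with hG
  have hd := (hD'.fun_inv hD.ne').fun_smul hq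
  constructor
  · intro hE
    have e := hd.unique hE
    have e0 (w : Plane) : (1 + h (P s) (u s) (μ • rotGen (P s))) * (q' w - G w) =
        (q' - G) (μ • rotGen (P s)) * h (P s) (u s) w := by
      have ew := DFunLike.congr_fun e w
      generalize (q' - G) (μ • rotGen (P s)) = k at ew ⊢
      generalize h (P s) (u s) (μ • rotGen (P s)) = d at *
      simp only [add_apply, smul_apply, smul_eq_mul] at ew
      field_simp at ew
      linarith
    -- With `k = (q' - G)(W)` and `d = h(u, W)`, `e0` at `W` reads `(1 + d) k = k d`.
    have hk : (q' - G) (μ • rotGen (P s)) = 0 := by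
      have e1 := e0 (μ • rotGen (P s))
      rw [← sub_apply] at e1
      linarith
    ext w
    have e1 := e0 w
    rw [hk, zero_mul] at e1
    have := (mul_eq_zero.1 e1).resolve_left hD.ne'
    linarith
  · intro hE
    refine hd.congr_deriv ?_
    rw [hE]
    simp

theorem isUnitSpeedGeodesicOn_rot_iff (hm : IsSurfaceOfRevolution h m) {μ : ℝ} (hμ : 0 < μ)
    (hbound : ∀ r : ℝ, 0 ≤ r → m r < 1 / μ) {I : Set ℝ} (hI : IsOpen I) {γ P : ℝ → Plane}
    (hP : ∀ t ∈ I, P t = rot (μ * t) (γ t)) :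
    IsUnitSpeedGeodesicOn (randers h (fun x => μ • dθ x)) I P ↔
      IsUnitSpeedGeodesicOn (riemannNorm h) I γ := by
  have hrot (c : ℝ) : ContDiff ℝ ∞ fun t => rot (c * t) :=
    contDiff_rot.comp (contDiff_const.mul contDiff_id)
  have hsmooth : ContDiffOn ℝ ∞ P I ↔ ContDiffOn ℝ ∞ γ I := by
    constructor
    · intro hc
      refine ((hrot (-μ)).contDiffOn.clm_apply hc).congr fun t ht => ?_
      simp [hP t ht]
    · intro hc
      exact ((hrot μ).contDiffOn.clm_apply hc).congr hP
  rw [IsUnitSpeedGeodesicOn, IsUnitSpeedGeodesicOn, hsmooth]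
  refine and_congr_right fun hγ => ?_
  have hγ' : ContDiffOn ℝ ∞ (deriv γ) I := hγ.deriv_of_isOpen hI (by simp)
  have hdiff {f : ℝ → Plane} (hf : ContDiffOn ℝ ∞ f I) (t : ℝ) (ht : t ∈ I) :
      HasDerivAt f (deriv f t) t :=
    ((hf.differentiableOn (by simp)).differentiableAt (hI.mem_nhds ht)).hasDerivAt
  set u : ℝ → Plane := fun t => rot (μ * t) (deriv γ t) with hu
  have hPd (t : ℝ) (ht : t ∈ I) : HasDerivAt P (u t + μ • rotGen (P t)) t := by
    have h1 := (hasDerivAt_rot_mul μ t).clm_apply (hdiff hγ t ht)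
    have h2 : P =ᶠ[nhds t] fun t => rot (μ * t) (γ t) := by
      filter_upwards [hI.mem_nhds ht] with x hx using hP x hx
    refine (h1.congr_of_eventuallyEq h2).congr_deriv ?_
    rw [hP t ht]
    simp [hu, add_comm]
  have hspeed (t : ℝ) (ht : t ∈ I) : randers h (fun x => μ • dθ x) (P t) (deriv P t) = 1 ↔
      riemannNorm h (γ t) (deriv γ t) = 1 := by
    rw [hm.randers_eq_one_iff hμ hbound, (hPd t ht).deriv, add_sub_cancel_right, hP t ht,
      hm.riemannNorm_rot]
  rw [forall₂_congr hspeed]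
  refine and_congr_right fun hγ1 => forall₂_congr fun s hs => ?_
  have hq := hm.hasDerivAt_momentum (hPd s hs)
    ((hasDerivAt_rot_mul μ s).clm_apply (hdiff hγ' s hs))
  rw [hm.euler_randers_iff hμ hbound hI hs hPd (fun t ht => (hspeed t ht).2 (hγ1 t ht)) hq,
    hm.euler_riemann_iff hI hs hP (fun _ _ => rfl) hq]

end IsSurfaceOfRevolution

end RandersRotational

end

theorem theorem1p1
    (h : RandersRotational.Plane →
      RandersRotational.Plane →L[ℝ] RandersRotational.Plane →L[ℝ] ℝ)
    (m : ℝ → ℝ) (hm : RandersRotational.IsSurfaceOfRevolution h m)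
    (μ : ℝ) (hμ : 0 < μ) (hbound : ∀ r : ℝ, 0 ≤ r → m r < 1 / μ)
    (I : Set ℝ) (hI : IsOpen I) (hI' : I.OrdConnected)
    (P : ℝ → RandersRotational.Plane) :
    RandersRotational.IsUnitSpeedGeodesicOn
        (RandersRotational.randers h (fun x => μ • RandersRotational.dθ x)) I P ↔
      ∃ r θ : ℝ → ℝ,
        (∀ s ∈ I, 0 ≤ r s) ∧
        RandersRotational.IsUnitSpeedGeodesicOn (RandersRotational.riemannNorm h) I
          (fun s => RandersRotational.polar (r s) (θ s)) ∧
        ∀ s ∈ I, P s = RandersRotational.polar (r s) (θ s + μ * s) := by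
  constructor
  · intro hP
    -- The polar coordinates are chosen pointwise, with no continuity: only the curve they represent
    -- must be smooth, which permits passage through the vertex.
    choose r θ hr hrθ using fun s => RandersRotational.exists_eq_polar
      (RandersRotational.rot (-(μ * s)) (P s))
    have hPr (s : ℝ) : P s = RandersRotational.rot (μ * s)
        (RandersRotational.polar (r s) (θ s)) := by
      rw [← hrθ, RandersRotational.rot_rot_neg]
    refine ⟨r, θ, fun s _ => hr s, ?_, fun s _ => ?_⟩
    · exact (hm.isUnitSpeedGeodesicOn_rot_iff hμ hbound hI fun s _ => hPr s).1 hP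
    · rw [hPr, RandersRotational.rot_polar]
  · rintro ⟨r, θ, -, hγ, hP⟩
    refine (hm.isUnitSpeedGeodesicOn_rot_iff hμ hbound hI fun s hs => ?_).2 hγ
    rw [hP s hs, RandersRotational.rot_polar]
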